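/- Let $K$ be an algebraically closed field of characteristic zero (for example $K=\mathbb{C}$), let $N\ge 0$, and let $X\subseteq\mathbb{P}^N=\mathbb{P}^N(K)$ be an irreducible (in particular non-empty, Zariski-closed) reduced projective variety. For $s\ge 1$ let \[\sigma_s(X)=\overline{\bigcup_{P_1,\ldots,P_s\in X}\langle P_1,\ldots,P_s\rangle}\] be its $s$-th higher secant variety, where $\langle\cdot\rangle$ denotes the linear span in $\mathbb{P}^N$ and the bar denotes the Zariski closure. Then: (1) If $i\ge 1$ and $\sigma_i(X)=\sigma_{i+1}(X)\neq\mathbb{P}^N$, then $\sigma_i(X)=\langle X\rangle$ is the linear span of $X$, and $\sigma_j(X)=\sigma_i(X)$ for all $j\ge i$. (2) If $X$ is non-degenerate, i.e. not contained in a hyperplane, then there exists an $r\ge 1$ such that \[X=\sigma_1(X)\subsetneq\sigma_2(X)\subsetneq\cdots\subsetneq\sigma_r(X)=\mathbb{P}^N.\] -/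

import Mathlib

namespace SecantVariety

open scoped LinearAlgebra.Projectivization

/-- Projective `N`-space over `K`: the lines through the origin of `K^(N+1)`. -/
abbrev ProjSpace (K : Type*) [Field K] (N : ℕ) : Type _ := ℙ K (Fin (N + 1) → K)

/-- The common zeros in projective space of a set of polynomials in `N + 1` variables. It is only
used for sets of homogeneous polynomials, for which it does not depend on the representatives. -/
def zeroLocus {K : Type*} [Field K] {N : ℕ} (S : Set (MvPolynomial (Fin (N + 1)) K)) :
    Set (ProjSpace K N) :=
  {p | ∀ f ∈ S, MvPolynomial.eval p.rep f = 0}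

/-- The vanishing of a homogeneous polynomial at a point of projective space may be tested on any
vector that represents the point. -/
theorem eval_rep_eq_zero_iff {K : Type*} [Field K] {N : ℕ} {f : MvPolynomial (Fin (N + 1)) K}
    {d : ℕ} (hf : f.IsHomogeneous d) (v : Fin (N + 1) → K) (hv : v ≠ 0) :
    MvPolynomial.eval (Projectivization.mk K v hv).rep f = 0 ↔ MvPolynomial.eval v f = 0 := by
  obtain ⟨a, ha⟩ := Projectivization.exists_smul_eq_mk_rep K v hv
  rw [← ha]
  have h : MvPolynomial.eval ((a : K) • v) f = (a : K) ^ d * MvPolynomial.eval v f := by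
    rw [MvPolynomial.eval_eq, MvPolynomial.eval_eq, Finset.mul_sum]
    refine Finset.sum_congr rfl fun m hm => ?_
    have hd : ∑ i ∈ m.support, m i = d := by
      rw [← hf (MvPolynomial.mem_support_iff.mp hm), Finsupp.weight_apply]
      simp [Finsupp.sum]
    simp only [Pi.smul_apply, smul_eq_mul, mul_pow, Finset.prod_mul_distrib]
    rw [Finset.prod_pow_eq_pow_sum, hd]
    ring
  rw [show a • v = (a : K) • v from rfl, h]
  simp

/-- A subset of projective space is algebraic if it is the common zero locus of a set of
homogeneous polynomials. -/
def IsAlgebraicSet {K : Type*} [Field K] {N : ℕ} (C : Set (ProjSpace K N)) : Prop :=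
  ∃ S : Set (MvPolynomial (Fin (N + 1)) K), (∀ f ∈ S, ∃ d, f.IsHomogeneous d) ∧ C = zeroLocus S

/-- The Zariski topology on projective space: the closed sets are the algebraic sets. -/
instance zariskiTopology (K : Type*) [Field K] (N : ℕ) : TopologicalSpace (ProjSpace K N) :=
  TopologicalSpace.ofClosed {C | IsAlgebraicSet C}
    ⟨{1}, by
      rintro f rfl
      exact ⟨0, MvPolynomial.isHomogeneous_one _ _⟩, by
      ext p
      simp [zeroLocus]⟩
    (by
      intro A hA
      refine ⟨{f | (∃ d, f.IsHomogeneous d) ∧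
        ∃ C ∈ A, ∀ p ∈ C, MvPolynomial.eval p.rep f = 0}, fun f hf => hf.1, ?_⟩
      ext p
      simp only [Set.mem_sInter, zeroLocus, Set.mem_ofPred_eq]
      constructor
      · rintro h f ⟨-, C, hC, hf⟩
        exact hf p (h C hC)
      · intro h C hC
        obtain ⟨S, hS, rfl⟩ := hA hC
        exact fun f hf => h f ⟨hS f hf, _, hC, fun q hq => hq f hf⟩)
    (by
      rintro A ⟨S, hS, rfl⟩ B ⟨T, hT, rfl⟩
      refine ⟨{h | ∃ f ∈ S, ∃ g ∈ T, h = f * g}, ?_, ?_⟩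
      · rintro h ⟨f, hf, g, hg, rfl⟩
        obtain ⟨d, hd⟩ := hS f hf
        obtain ⟨e, he⟩ := hT g hg
        exact ⟨d + e, hd.mul he⟩
      · ext p
        simp only [Set.mem_union, zeroLocus, Set.mem_ofPred_eq]
        constructor
        · rintro (h | h) _ ⟨f, hf, g, hg, rfl⟩
          · simp [h f hf]
          · simp [h g hg]
        · intro h
          by_contra! hc
          obtain ⟨⟨f, hf, hfp⟩, g, hg, hgp⟩ := hc
          have := h _ ⟨f, hf, g, hg, rfl⟩
          simp [hfp, hgp] at this)

theorem isClosed_iff {K : Type*} [Field K] {N : ℕ} (C : Set (ProjSpace K N)) :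
    IsClosed C ↔ IsAlgebraicSet C :=
  ⟨fun h => by
    have h' := h.isOpen_compl
    change IsAlgebraicSet Cᶜᶜ at h'
    rwa [compl_compl] at h', fun h => ⟨by
    change IsAlgebraicSet Cᶜᶜ
    rwa [compl_compl]⟩⟩

/-- An irreducible (reduced) projective variety in `ℙ^N`, given by its set of points: a non-empty
irreducible Zariski-closed subset. -/
def IsProjectiveVariety {K : Type*} [Field K] {N : ℕ} (X : Set (ProjSpace K N)) : Prop :=
  IsClosed X ∧ IsIrreducible X

/-- The `s`-th higher secant variety `σ_s(X)`: the Zariski closure of the union of the linear spans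
of `s` (not necessarily distinct) points of `X`. -/
def sigma {K : Type*} [Field K] {N : ℕ} (s : ℕ) (X : Set (ProjSpace K N)) :
    Set (ProjSpace K N) :=
  closure (⋃ (P : Fin s → ProjSpace K N) (_ : ∀ i, P i ∈ X),
    (Projectivization.Subspace.span (Set.range P) : Set (ProjSpace K N)))

/-- A hyperplane of projective space: the zeros of a nonzero linear form. -/
def IsHyperplane {K : Type*} [Field K] {N : ℕ} (H : Set (ProjSpace K N)) : Prop :=
  ∃ l : Module.Dual K (Fin (N + 1) → K), l ≠ 0 ∧ H = {p | l p.rep = 0}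

/-- `X` is non-degenerate if it is not contained in a hyperplane. -/
def IsNondegenerate {K : Type*} [Field K] {N : ℕ} (X : Set (ProjSpace K N)) : Prop :=
  ∀ H : Set (ProjSpace K N), IsHyperplane H → ¬ X ⊆ H

end SecantVariety

/-!
The sets `σ_s(X)` are closures of linear combinations of `s` vectors over `X`, so everything is
done with vectors: `secantCone s X` is the set of all `∑ cᵢ xᵢ` with `xᵢ` representing a point of
`X`, and `σ_{s+1}` is obtained from `σ_s` by adding multiples of one more such vector.

The main point is `mk_add_smul_rep_mem_sigma`: if `Y = σ_i(X) = σ_{i+1}(X)`, then `Y` contains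
the line joining any of its points to any point `x` of `X`. For the points of `Y` lying on honest
`i`-secant spaces this is clear. To pass to the closure, let `f` be a form vanishing on `Y`; the
polynomial `v ↦ f (v + c x)` vanishes on `secantCone i X`, which is stable under scaling, so, the
field being infinite, all of its homogeneous components vanish there, hence also on the closure `Y`.

Consequently the affine cone over `Y` contains every linear combination of vectors over `X`, that
is, `Y` contains the linear span `⟨X⟩`. As linear subspaces are Zariski closed, all `σ_s(X)` lie
in `⟨X⟩`, so the chain is constant from `i` on with value `⟨X⟩`
(`sigma_eq_span_of_sigma_eq_sigma_succ`). If `X` is non-degenerate, then `⟨X⟩` is the whole space,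
spanned by `N + 1` points of `X`; the chain therefore reaches `ℙ^N`, and the first part shows that
it increases strictly until it does for the first time.
-/

namespace SecantVariety

open scoped LinearAlgebra.Projectivization

variable {K : Type*} [Field K] {N : ℕ}

/-! ### Linear spans and their vectors -/

theorem span_eq_projectivization_span_rep (S : Set (ProjSpace K N)) :
    Projectivization.Subspace.span S =
      (Submodule.span K (Projectivization.rep '' S)).projectivization := by
  apply le_antisymm
  · rw [Projectivization.Subspace.span_le_subspace_iff]
    intro p hp
    rw [← p.mk_rep]
    exact Submodule.subset_span ⟨p, hp, rfl⟩
  · have h : Submodule.span K (Projectivization.rep '' S) ≤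
        Projectivization.Subspace.submodule (Projectivization.Subspace.span S) := by
      rw [Submodule.span_le]
      rintro _ ⟨p, hp, rfl⟩
      rw [SetLike.mem_coe, Projectivization.Subspace.mem_submodule_iff _ p.rep_nonzero, p.mk_rep]
      exact Projectivization.Subspace.subset_span S hp
    exact (OrderIso.symm_apply_le _).mpr h

theorem mem_span_iff_rep_mem_span (S : Set (ProjSpace K N)) (p : ProjSpace K N) :
    p ∈ Projectivization.Subspace.span S ↔
      p.rep ∈ Submodule.span K (Projectivization.rep '' S) := by
  rw [span_eq_projectivization_span_rep]
  conv_lhs => rw [← p.mk_rep]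
  exact Submodule.mk_mem_projectivization_iff _ _

/-- The linear form `l`, as a homogeneous polynomial of degree one. -/
noncomputable def linearPolynomial (l : Module.Dual K (Fin (N + 1) → K)) :
    MvPolynomial (Fin (N + 1)) K :=
  ∑ i, MvPolynomial.C (l (Pi.single i 1)) * MvPolynomial.X i

theorem linearPolynomial_isHomogeneous (l : Module.Dual K (Fin (N + 1) → K)) :
    (linearPolynomial l).IsHomogeneous 1 :=
  MvPolynomial.IsHomogeneous.sum _ _ _ fun i _ => MvPolynomial.isHomogeneous_C_mul_X _ i

theorem eval_linearPolynomial (l : Module.Dual K (Fin (N + 1) → K)) (v : Fin (N + 1) → K) :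
    MvPolynomial.eval v (linearPolynomial l) = l v := by
  conv_rhs => rw [pi_eq_sum_univ' v]
  simp [linearPolynomial, mul_comm]

theorem isClosed_projectivization (W : Submodule K (Fin (N + 1) → K)) :
    IsClosed (W.projectivization : Set (ProjSpace K N)) := by
  rw [isClosed_iff]
  refine ⟨linearPolynomial '' {l | W ≤ LinearMap.ker l}, ?_, ?_⟩
  · rintro _ ⟨l, -, rfl⟩
    exact ⟨1, linearPolynomial_isHomogeneous l⟩
  · ext p
    have hp : p ∈ W.projectivization ↔ p.rep ∈ W := by
      conv_lhs => rw [← p.mk_rep]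
      exact Submodule.mk_mem_projectivization_iff _ _
    rw [SetLike.mem_coe, hp]
    constructor
    · rintro h _ ⟨l, hl, rfl⟩
      rw [eval_linearPolynomial]
      exact hl h
    · intro h
      by_contra hn
      obtain ⟨l, hl, hW⟩ := Submodule.exists_le_ker_of_notMem hn
      refine hl ?_
      rw [← eval_linearPolynomial]
      exact h _ ⟨l, hW, rfl⟩

theorem isClosed_span (S : Set (ProjSpace K N)) :
    IsClosed (Projectivization.Subspace.span S : Set (ProjSpace K N)) := by
  rw [span_eq_projectivization_span_rep]
  exact isClosed_projectivization _

theorem IsNondegenerate.span_rep_eq_top {X : Set (ProjSpace K N)} (hX : IsNondegenerate X) :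
    Submodule.span K (Projectivization.rep '' X) = ⊤ := by
  by_contra h
  obtain ⟨l, hl, hle⟩ := Submodule.exists_le_ker_of_lt_top _ (lt_top_iff_ne_top.mpr h)
  exact hX _ ⟨l, hl, rfl⟩ fun p hp => hle (Submodule.subset_span ⟨p, hp, rfl⟩)

/-! ### Forms vanishing on a set and on its closure -/

theorem eval_smul_of_isHomogeneous {f : MvPolynomial (Fin (N + 1)) K} {d : ℕ}
    (hf : f.IsHomogeneous d) (a : K) (v : Fin (N + 1) → K) :
    MvPolynomial.eval (a • v) f = a ^ d * MvPolynomial.eval v f := by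
  rw [MvPolynomial.eval_eq, MvPolynomial.eval_eq, Finset.mul_sum]
  refine Finset.sum_congr rfl fun m hm => ?_
  have hd : ∑ i ∈ m.support, m i = d := by
    rw [← hf (MvPolynomial.mem_support_iff.mp hm), Finsupp.weight_apply]
    simp [Finsupp.sum]
  simp only [Pi.smul_apply, smul_eq_mul, mul_pow, Finset.prod_mul_distrib]
  rw [Finset.prod_pow_eq_pow_sum, hd]
  ring

theorem mem_closure_iff_forall_eval_eq_zero (U : Set (ProjSpace K N)) (p : ProjSpace K N) :
    p ∈ closure U ↔ ∀ (f : MvPolynomial (Fin (N + 1)) K) (d : ℕ), f.IsHomogeneous d →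
      (∀ q ∈ U, MvPolynomial.eval q.rep f = 0) → MvPolynomial.eval p.rep f = 0 := by
  constructor
  · intro hp f d hf hU
    have hc : IsClosed (zeroLocus {f} : Set (ProjSpace K N)) :=
      (isClosed_iff _).mpr ⟨{f}, by rintro _ rfl; exact ⟨d, hf⟩, rfl⟩
    exact closure_minimal (fun q hq => by rintro _ rfl; exact hU q hq) hc hp f rfl
  · intro h
    obtain ⟨S, hS, hUS⟩ := (isClosed_iff _).mp (isClosed_closure (s := U))
    rw [hUS]
    intro f hf
    obtain ⟨d, hd⟩ := hS f hf
    refine h f d hd fun q hq => ?_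
    have hq' := subset_closure hq
    rw [hUS] at hq'
    exact hq' f hf

/-- Over an infinite field, a polynomial that vanishes on the line through `v` has homogeneous
components that vanish at `v`: they are the coefficients of its restriction to the line. -/
theorem eval_homogeneousComponent_eq_zero [Infinite K] (g : MvPolynomial (Fin (N + 1)) K)
    (v : Fin (N + 1) → K) (h : ∀ t : K, MvPolynomial.eval (t • v) g = 0) (n : ℕ) :
    MvPolynomial.eval v (MvPolynomial.homogeneousComponent n g) = 0 := by
  by_cases hn : g.totalDegree < n
  · rw [MvPolynomial.homogeneousComponent_eq_zero _ _ hn, map_zero]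
  let P : Polynomial K := ∑ k ∈ Finset.range (g.totalDegree + 1),
    Polynomial.monomial k (MvPolynomial.eval v (MvPolynomial.homogeneousComponent k g))
  have hP : P = 0 := by
    refine P.zero_of_eval_zero fun t => ?_
    rw [← h t]
    conv_rhs => rw [← MvPolynomial.sum_homogeneousComponent g]
    rw [Polynomial.eval_finsetSum, map_sum]
    refine Finset.sum_congr rfl fun k _ => ?_
    rw [Polynomial.eval_monomial, eval_smul_of_isHomogeneous
      (MvPolynomial.homogeneousComponent_isHomogeneous k g), mul_comm]
  have hc := congrArg (fun Q : Polynomial K => Q.coeff n) hP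
  simpa [P, Polynomial.finsetSum_coeff, Polynomial.coeff_monomial, Nat.lt_succ_iff,
    not_lt.mp hn] using hc

/-! ### The cone of secant vectors -/

/-- The set of all linear combinations of `s` vectors that represent points of `X`: the vectors
of the linear spans of `s` points of `X`, together with zero if `s = 0` or `X` is non-empty. -/
def secantCone (s : ℕ) (X : Set (ProjSpace K N)) : Set (Fin (N + 1) → K) :=
  {v | ∃ P : Fin s → ProjSpace K N, (∀ i, P i ∈ X) ∧ ∃ c : Fin s → K, ∑ i, c i • (P i).rep = v}

theorem smul_mem_secantCone {s : ℕ} {X : Set (ProjSpace K N)} {v : Fin (N + 1) → K}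
    (hv : v ∈ secantCone s X) (t : K) : t • v ∈ secantCone s X := by
  obtain ⟨P, hP, c, rfl⟩ := hv
  exact ⟨P, hP, fun i => t * c i, by simp [Finset.smul_sum, mul_smul]⟩

theorem mem_secantCone_succ {s : ℕ} {X : Set (ProjSpace K N)} {v : Fin (N + 1) → K} :
    v ∈ secantCone (s + 1) X ↔
      ∃ w ∈ secantCone s X, ∃ x ∈ X, ∃ a : K, w + a • x.rep = v := by
  constructor
  · rintro ⟨P, hP, c, rfl⟩
    exact ⟨_, ⟨fun i => P i.castSucc, fun i => hP _, fun i => c i.castSucc, rfl⟩,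
      P (Fin.last s), hP _, c (Fin.last s), (Fin.sum_univ_castSucc fun i => c i • (P i).rep).symm⟩
  · rintro ⟨_, ⟨P, hP, c, rfl⟩, x, hx, a, rfl⟩
    refine ⟨Fin.snoc P x, fun i => ?_, Fin.snoc c a, ?_⟩
    · refine Fin.lastCases ?_ (fun j => ?_) i
      · simpa using hx
      · simpa using hP j
    · simp [Fin.sum_univ_castSucc]

theorem exists_mem_secantCone_of_mem_span {X : Set (ProjSpace K N)} {v : Fin (N + 1) → K}
    (hv : v ∈ Submodule.span K (Projectivization.rep '' X)) : ∃ s, v ∈ secantCone s X := by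
  obtain ⟨n, c, g, rfl⟩ := Submodule.mem_span_set'.mp hv
  choose P hP hPg using fun i => (g i).2
  exact ⟨n, P, hP, c, by simp [hPg]⟩

/-- `σ_s(X)` is the closure of the set of points represented by vectors of the secant cone. -/
theorem sigma_eq_closure_secantCone (s : ℕ) (X : Set (ProjSpace K N)) :
    sigma s X = closure {p | p.rep ∈ secantCone s X} := by
  unfold sigma
  congr 1
  ext p
  simp only [Set.mem_iUnion, SetLike.mem_coe, mem_span_iff_rep_mem_span, ← Set.range_comp,
    Submodule.mem_span_range_iff_exists_fun, secantCone, Set.mem_ofPred_eq, exists_prop,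
    Function.comp_apply]

theorem sigma_subset_span (s : ℕ) (X : Set (ProjSpace K N)) :
    sigma s X ⊆ Projectivization.Subspace.span X := by
  refine closure_minimal (Set.iUnion₂_subset fun P hP => ?_) (isClosed_span X)
  exact Projectivization.Subspace.span_le_span (Set.range_subset_iff.mpr hP)

theorem sigma_subset_sigma_succ {s : ℕ} {X : Set (ProjSpace K N)} (hX : X.Nonempty) :
    sigma s X ⊆ sigma (s + 1) X := by
  obtain ⟨x, hx⟩ := hX
  simp only [sigma_eq_closure_secantCone]
  exact closure_mono fun p hp => mem_secantCone_succ.mpr ⟨_, hp, x, hx, 0, by simp⟩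

theorem sigma_subset_sigma {s t : ℕ} {X : Set (ProjSpace K N)} (hX : X.Nonempty) (h : s ≤ t) :
    sigma s X ⊆ sigma t X :=
  monotone_nat_of_le_succ (f := fun n => sigma n X) (fun _ => sigma_subset_sigma_succ hX) h

theorem sigma_one {X : Set (ProjSpace K N)} (hX : IsClosed X) : sigma 1 X = X := by
  rw [sigma_eq_closure_secantCone]
  convert hX.closure_eq using 2
  ext p
  constructor
  · rintro ⟨P, hP, c, hc⟩
    have : p = P 0 := by
      rw [← p.mk_rep, ← (P 0).mk_rep, Projectivization.mk_eq_mk_iff']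
      exact ⟨c 0, by simpa using hc⟩
    exact this ▸ hP 0
  · intro hp
    exact ⟨fun _ => p, fun _ => hp, fun _ => 1, by simp⟩

theorem subset_sigma {s : ℕ} (hs : 1 ≤ s) {X : Set (ProjSpace K N)} (hX : X.Nonempty)
    (hc : IsClosed X) : X ⊆ sigma s X := by
  simpa only [sigma_one hc] using sigma_subset_sigma hX hs

/-- A form vanishing on `σ_s(X)` vanishes on the secant cone. The vector zero needs care, as the
form may be constant; it is reached by scaling a point of `X`. -/
theorem eval_eq_zero_of_mem_secantCone {s : ℕ} (hs : 1 ≤ s) {X : Set (ProjSpace K N)}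
    (hX : X.Nonempty) (hc : IsClosed X) {f : MvPolynomial (Fin (N + 1)) K} {d : ℕ}
    (hf : f.IsHomogeneous d) (h : ∀ p ∈ sigma s X, MvPolynomial.eval p.rep f = 0)
    {v : Fin (N + 1) → K} (hv : v ∈ secantCone s X) : MvPolynomial.eval v f = 0 := by
  rcases eq_or_ne v 0 with rfl | hv0
  · obtain ⟨x, hx⟩ := hX
    rw [← zero_smul K x.rep, eval_smul_of_isHomogeneous hf,
      h x (subset_sigma hs ⟨x, hx⟩ hc hx), mul_zero]
  · rw [← eval_rep_eq_zero_iff hf v hv0]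
    refine h _ ?_
    rw [sigma_eq_closure_secantCone]
    refine subset_closure ?_
    obtain ⟨a, ha⟩ := Projectivization.exists_smul_eq_mk_rep K v hv0
    rw [Set.mem_ofPred_eq, ← ha]
    exact smul_mem_secantCone hv (a : K)

/-! ### Stabilization of the chain of secant varieties -/

/-- If `σ_i(X) = σ_{i+1}(X)`, then this variety contains the join of each of its points with each
point of `X`. -/
theorem mk_add_smul_rep_mem_sigma [Infinite K] {i : ℕ} {X : Set (ProjSpace K N)}
    (hX : X.Nonempty) (hc : IsClosed X) (heq : sigma i X = sigma (i + 1) X)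
    {y x : ProjSpace K N} (hy : y ∈ sigma i X) (hx : x ∈ X) (c : K)
    (h0 : y.rep + c • x.rep ≠ 0) : Projectivization.mk K (y.rep + c • x.rep) h0 ∈ sigma i X := by
  have hcl : IsClosed (sigma i X) := isClosed_closure
  rw [← hcl.closure_eq, mem_closure_iff_forall_eval_eq_zero]
  intro f d hf hfY
  rw [eval_rep_eq_zero_iff hf]
  -- `g` is the polynomial function `v ↦ f (v + c x)`, which need not be homogeneous.
  let g : MvPolynomial (Fin (N + 1)) K :=
    MvPolynomial.bind₁ (fun j => MvPolynomial.X j + MvPolynomial.C (c * x.rep j)) f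
  have hg : ∀ v, MvPolynomial.eval v g = MvPolynomial.eval (v + c • x.rep) f := fun v => by
    simp only [g, ← MvPolynomial.aeval_eq_eval, MvPolynomial.aeval_bind₁]
    congr 2
    ext j
    simp
  have hgS : ∀ v ∈ secantCone i X, MvPolynomial.eval v g = 0 := fun v hv => by
    rw [hg]
    exact eval_eq_zero_of_mem_secantCone (Nat.le_add_left 1 i) hX hc hf (heq ▸ hfY)
      (mem_secantCone_succ.mpr ⟨v, hv, x, hx, c, rfl⟩)
  rw [sigma_eq_closure_secantCone, mem_closure_iff_forall_eval_eq_zero] at hy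
  rw [← hg, ← MvPolynomial.sum_homogeneousComponent g, map_sum]
  refine Finset.sum_eq_zero fun n _ => hy _ n
    (MvPolynomial.homogeneousComponent_isHomogeneous n g) fun q hq => ?_
  exact eval_homogeneousComponent_eq_zero g q.rep
    (fun t => hgS _ (smul_mem_secantCone hq t)) n

/-- If `σ_i(X) = σ_{i+1}(X)`, then the affine cone over this variety contains every secant cone. -/
theorem mk_mem_sigma_of_mem_secantCone [Infinite K] {i : ℕ} (hi : 1 ≤ i)
    {X : Set (ProjSpace K N)} (hX : X.Nonempty) (hc : IsClosed X)
    (heq : sigma i X = sigma (i + 1) X) (s : ℕ) :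
    ∀ v ∈ secantCone s X, ∀ hv : v ≠ 0, Projectivization.mk K v hv ∈ sigma i X := by
  induction s with
  | zero =>
    rintro _ ⟨P, -, c, rfl⟩ hv
    exact absurd (by simp) hv
  | succ s ih =>
    intro v hvs hv
    obtain ⟨w, hw, x, hx, a, rfl⟩ := mem_secantCone_succ.mp hvs
    rcases eq_or_ne w 0 with rfl | hw0
    · have hxe : Projectivization.mk K (0 + a • x.rep) hv = x := by
        conv_rhs => rw [← x.mk_rep]
        rw [Projectivization.mk_eq_mk_iff']
        exact ⟨a, by simp⟩
      rw [hxe]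
      exact subset_sigma hi hX hc hx
    · obtain ⟨b, hb⟩ := Projectivization.exists_smul_eq_mk_rep K w hw0
      have he : (Projectivization.mk K w hw0).rep + ((b : K) * a) • x.rep =
          (b : K) • (w + a • x.rep) := by
        rw [← hb, smul_add, mul_smul]
        rfl
      have h0 : (Projectivization.mk K w hw0).rep + ((b : K) * a) • x.rep ≠ 0 := by
        rw [he]
        exact smul_ne_zero b.ne_zero hv
      have := mk_add_smul_rep_mem_sigma hX hc heq (ih w hw hw0) hx ((b : K) * a) h0
      convert this using 1
      rw [Projectivization.mk_eq_mk_iff']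
      exact ⟨(b : K)⁻¹, by rw [he, inv_smul_smul₀ b.ne_zero]⟩

theorem sigma_eq_span_of_sigma_eq_sigma_succ [Infinite K] {i : ℕ} (hi : 1 ≤ i)
    {X : Set (ProjSpace K N)} (hX : X.Nonempty) (hc : IsClosed X)
    (heq : sigma i X = sigma (i + 1) X) :
    sigma i X = (Projectivization.Subspace.span X : Set (ProjSpace K N)) := by
  refine (sigma_subset_span i X).antisymm fun p hp => ?_
  obtain ⟨s, hs⟩ := exists_mem_secantCone_of_mem_span ((mem_span_iff_rep_mem_span X p).mp hp)
  simpa only [p.mk_rep] using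
    mk_mem_sigma_of_mem_secantCone hi hX hc heq s p.rep hs p.rep_nonzero

/-! ### Non-degenerate varieties -/

theorem IsNondegenerate.span_eq_univ {X : Set (ProjSpace K N)} (hX : IsNondegenerate X) :
    (Projectivization.Subspace.span X : Set (ProjSpace K N)) = Set.univ :=
  Set.eq_univ_of_forall fun p =>
    (mem_span_iff_rep_mem_span X p).mpr (hX.span_rep_eq_top ▸ Submodule.mem_top)

/-- The span of `X` is attained by `N + 1` points, so `σ_{N+1}(X)` is the whole space. -/
theorem IsNondegenerate.sigma_eq_univ {X : Set (ProjSpace K N)} (hX : IsNondegenerate X) :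
    sigma (N + 1) X = Set.univ := by
  have hfin : Module.finrank K (Submodule.span K (Projectivization.rep '' X)) = N + 1 := by
    rw [hX.span_rep_eq_top, finrank_top, Module.finrank_fin_fun]
  have hbasis := Submodule.exists_fun_fin_finrank_span_eq K (Projectivization.rep '' X)
  rw [hfin] at hbasis
  obtain ⟨b, hb, hspan, -⟩ := hbasis
  choose P hP hPb using hb
  rw [sigma_eq_closure_secantCone]
  refine Set.eq_univ_of_forall fun p => subset_closure ?_
  have hp : p.rep ∈ Submodule.span K (Set.range b) := by
    rw [hspan, hX.span_rep_eq_top]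
    exact Submodule.mem_top
  obtain ⟨c, hcp⟩ := (Submodule.mem_span_range_iff_exists_fun K).mp hp
  exact ⟨P, hP, c, by simpa only [hPb] using hcp⟩

end SecantVariety

theorem mainTheorem7 {K : Type*} [Field K] [IsAlgClosed K] [CharZero K] (N : ℕ)
    (X : Set (SecantVariety.ProjSpace K N)) (hX : SecantVariety.IsProjectiveVariety X) :
    (∀ i : ℕ, 1 ≤ i →
      SecantVariety.sigma i X = SecantVariety.sigma (i + 1) X →
      SecantVariety.sigma i X ≠ Set.univ →
        SecantVariety.sigma i X =
            (Projectivization.Subspace.span X : Set (SecantVariety.ProjSpace K N)) ∧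
          ∀ j : ℕ, i ≤ j → SecantVariety.sigma j X = SecantVariety.sigma i X) ∧
    (SecantVariety.IsNondegenerate X →
      ∃ r : ℕ, 1 ≤ r ∧
        X = SecantVariety.sigma 1 X ∧
        (∀ s : ℕ, 1 ≤ s → s < r → SecantVariety.sigma s X ⊂ SecantVariety.sigma (s + 1) X) ∧
        SecantVariety.sigma r X = Set.univ) := by
  obtain ⟨hc, hX, -⟩ := hX
  refine ⟨fun i hi heq _ => ?_, fun hnd => ?_⟩
  · have h := SecantVariety.sigma_eq_span_of_sigma_eq_sigma_succ hi hX hc heq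
    refine ⟨h, fun j hij => (SecantVariety.sigma_subset_sigma hX hij).antisymm' ?_⟩
    rw [h]
    exact SecantVariety.sigma_subset_span j X
  · classical
    have hex : ∃ r, 1 ≤ r ∧ SecantVariety.sigma r X = Set.univ :=
      ⟨N + 1, Nat.le_add_left 1 N, hnd.sigma_eq_univ⟩
    refine ⟨Nat.find hex, (Nat.find_spec hex).1, (SecantVariety.sigma_one hc).symm,
      fun s hs hsr => ?_, (Nat.find_spec hex).2⟩
    refine (SecantVariety.sigma_subset_sigma_succ hX).ssubset_of_ne fun heq => ?_
    refine Nat.find_min hex hsr ⟨hs, ?_⟩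
    rw [SecantVariety.sigma_eq_span_of_sigma_eq_sigma_succ hs hX hc heq, hnd.span_eq_univ]
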